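/- For real constants $a,b,c,d,e,f$ let $\Gamma(a,b,c,d,e,f)$ denote the torsion-free connection $\nabla$ on $\mathbb{R}^2$ with $\nabla_{\partial_{x^i}}\partial_{x^j}=\Gamma_{ij}^k\,\partial_{x^k}$ and constant Christoffel symbols $$\Gamma_{11}^1=a,\quad \Gamma_{11}^2=b,\quad \Gamma_{12}^1=\Gamma_{21}^1=c,\quad \Gamma_{12}^2=\Gamma_{21}^2=d,\quad \Gamma_{22}^1=e,\quad \Gamma_{22}^2=f.$$ Consider the following connections (those whose Ricci tensor has rank one, up to linear equivalence): $$\begin{aligned} \Gamma_1^1&:=\Gamma(-1,0,1,0,0,2),\\ \Gamma_2^1(c)&:=\Gamma(-1,0,c,0,0,1+2c)\quad (c\in\mathbb{R}\setminus\{0,-1\}),\\ \Gamma_3^1(c)&:=\Gamma(0,0,c,0,0,1+2c)\quad (c\in\mathbb{R}\setminus\{0,-1\}),\\ \Gamma_4^1(c)&:=\Gamma(0,0,1,0,c,2)\quad (c\in\mathbb{R}),\\ \Gamma_5^1(c)&:=\Gamma(1,0,0,0,1+c^2,2c)\quad (c\in\mathbb{R}). \end{aligned}$$ Two such connections $\nabla,\tilde\nabla$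 are called affine equivalent (i.e. locally affine isomorphic) if there is a smooth diffeomorphism $T$ from a non-empty open subset of $\mathbb{R}^2$ onto an open subset of $\mathbb{R}^2$ which intertwines them, i.e. $T_*(\nabla_XY)=\tilde\nabla_{T_*X}T_*Y$ for all smooth vector fields $X,Y$ on the domain of $T$. (Translations preserve all these connections, so $T$ can then be chosen to send any given point to any other.) **Theorem 3.7.** The following are all the affine equivalences between these connections. 1. $\Gamma_1^1$ and the $\Gamma_4^1(c)$, $c\in\mathbb{R}$, are all mutually affine equivalent. 2. For $i,j\in\{2,3\}$ and $c,\tilde c\in\mathbb{R}\setminus\{0,-1\}$, $\Gamma_i^1(c)$ is affine equivalent to $\Gamma_j^1(\tilde c)$ if and only if $\tilde c=c$ or $\tilde c=-1-c$. 3. For $c,\tilde c\in\mathbb{R}$, $\Gamma_5^1(c)$ is affine equivalent to $\Gamma_5^1(\tilde c)$ if and only if $c=\pm\tilde c$. In particular, no connection in one of the three classes $\{\Gamma_1^1,\Gamma_4^1(c)\}$, $\{\Gamma_2^1(c),\Gamma_3^1(c)\}$, $\{\Gamma_5^1(c)\}$ is affine equivalent to a connection in another of these classes. -/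

import Mathlib

open scoped Manifold ContDiff

namespace AffineSurface

/-- The underlying manifold `ℝ²`; the coordinates `x¹, x²` are the entries with index `0, 1`. -/
abbrev Plane : Type := Fin 2 → ℝ

/-- The six real constants `(a, b, c, d, e, f)` of a Type A connection `Γ(a, b, c, d, e, f)`. -/
@[ext]
structure TypeA where
  a : ℝ
  b : ℝ
  c : ℝ
  d : ℝ
  e : ℝ
  f : ℝ

namespace TypeA

/-- The Christoffel symbols of `Γ(a, b, c, d, e, f)`: `christoffel i j k` is `Γ_{ij}^k`, that is
`Γ₁₁¹ = a`, `Γ₁₁² = b`, `Γ₁₂¹ = Γ₂₁¹ = c`, `Γ₁₂² = Γ₂₁² = d`, `Γ₂₂¹ = e`, `Γ₂₂² = f`. -/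
def christoffel (G : TypeA) : Fin 2 → Fin 2 → Fin 2 → ℝ :=
  ![![![G.a, G.b], ![G.c, G.d]], ![![G.c, G.d], ![G.e, G.f]]]

/-- The constant bilinear map `(u, v) ↦ Γ_{ij}^k uⁱ vʲ ∂_k`, as a linear map in `u`. -/
noncomputable def bilin (G : TypeA) (v : Plane) : Plane →L[ℝ] Plane :=
  LinearMap.toContinuousLinearMap
    { toFun := fun u k => ∑ i, ∑ j, G.christoffel i j k * u i * v j
      map_add' := fun u w => by
        ext k
        simp only [Pi.add_apply, ← Finset.sum_add_distrib]
        exact Finset.sum_congr rfl fun i _ => Finset.sum_congr rfl fun j _ => by ring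
      map_smul' := fun r u => by
        ext k
        simp only [Pi.smul_apply, smul_eq_mul, RingHom.id_apply, Finset.mul_sum]
        exact Finset.sum_congr rfl fun i _ => Finset.sum_congr rfl fun j _ => by ring }

theorem bilin_apply (G : TypeA) (v u : Plane) (k : Fin 2) :
    G.bilin v u k = ∑ i, ∑ j, G.christoffel i j k * u i * v j := rfl

/-- `(∇_X Y)(p) = DY(p) X(p) + Γ_{ij}^k Xⁱ(p) Yʲ(p) ∂_k`, as a linear map in `X(p)`. -/
noncomputable def covDeriv (G : TypeA) (Y : Plane → Plane) (p : Plane) : Plane →L[ℝ] Plane :=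
  fderiv ℝ Y p + G.bilin (Y p)

theorem covDeriv_apply (G : TypeA) (Y : Plane → Plane) (p u : Plane) (k : Fin 2) :
    G.covDeriv Y p u k =
      fderiv ℝ Y p u k + ∑ i, ∑ j, G.christoffel i j k * u i * Y p j := rfl

theorem covDeriv_add (G : TypeA) {Y Z : Plane → Plane} {p : Plane}
    (hY : DifferentiableAt ℝ Y p) (hZ : DifferentiableAt ℝ Z p) :
    G.covDeriv (Y + Z) p = G.covDeriv Y p + G.covDeriv Z p := by
  ext u k
  simp only [add_apply, Pi.add_apply, covDeriv_apply, Fin.sum_univ_two,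
    fderiv_add hY hZ]
  ring

theorem covDeriv_smul (G : TypeA) {Y : Plane → Plane} {g : Plane → ℝ} {p : Plane}
    (hY : DifferentiableAt ℝ Y p) (hg : DifferentiableAt ℝ g p) :
    G.covDeriv (g • Y) p = g p • G.covDeriv Y p + (fderiv ℝ g p).smulRight (Y p) := by
  ext u k
  simp only [add_apply, smul_apply,
    ContinuousLinearMap.smulRight_apply, Pi.add_apply, Pi.smul_apply, smul_eq_mul, Pi.smul_apply',
    covDeriv_apply, Fin.sum_univ_two, fderiv_smul hg hY]
  ring

/-- A vector field on `ℝ²` that is differentiable at `p` as a section of the tangent bundle is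
differentiable at `p` as a map. -/
theorem differentiableAt_of_section {Y : Plane → Plane} {p : Plane}
    (hY : MDifferentiableAt 𝓘(ℝ, Plane) 𝓘(ℝ, Plane).tangent
      (fun q => (⟨q, Y q⟩ : TangentBundle 𝓘(ℝ, Plane) Plane)) p) :
    DifferentiableAt ℝ Y p := by
  have h := (mdifferentiableAt_section 𝓘(ℝ, Plane)
    (E := (TangentSpace 𝓘(ℝ, Plane) : Plane → Type)) Y).1 hY
  have h' : MDifferentiableAt 𝓘(ℝ, Plane) 𝓘(ℝ, Plane) Y p := by simpa using h
  exact mdifferentiableAt_iff_differentiableAt.1 h'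

/-- The Type A connection `∇` on the tangent bundle of `ℝ²` with `∇_{∂_i} ∂_j = Γ_{ij}^k ∂_k`.
`G.connection Y p (X p)` is `(∇_X Y)(p)`. -/
noncomputable def connection (G : TypeA) :
    CovariantDerivative 𝓘(ℝ, Plane) Plane (TangentSpace 𝓘(ℝ, Plane) : Plane → Type) where
  toFun := G.covDeriv
  isCovariantDerivativeOnUniv :=
    { add := fun hY hZ _ =>
        G.covDeriv_add (differentiableAt_of_section hY) (differentiableAt_of_section hZ)
      leibniz := fun hY hg _ => by
        have h := G.covDeriv_smul (differentiableAt_of_section hY)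
          (mdifferentiableAt_iff_differentiableAt.1 hg)
        rw [← mfderiv_eq_fderiv] at h
        exact h }

theorem connection_apply (G : TypeA) (Y : Plane → Plane) (p : Plane) :
    G.connection Y p = G.covDeriv Y p := rfl

end TypeA

/-- A smooth map `T`, defined on the open set `U` with values in the open set `V`, *intertwines*
the connections `∇` on `U` and `∇'` on `V`: whenever smooth vector fields `X, Y` on `U` are
`T`-related to smooth vector fields `X', Y'` on `V`, then `∇_X Y` is `T`-related to `∇'_{X'} Y'`.
When `T : U → V` is a diffeomorphism, `X'` and `Y'` are the push-forwards of `X` and `Y`. -/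
def Intertwines
    (nabla nabla' :
      CovariantDerivative 𝓘(ℝ, Plane) Plane (TangentSpace 𝓘(ℝ, Plane) : Plane → Type))
    (T : Plane → Plane) (U V : Set Plane) : Prop :=
  ∀ X Y X' Y' : Plane → Plane,
    ContDiffOn ℝ ∞ X U → ContDiffOn ℝ ∞ Y U → ContDiffOn ℝ ∞ X' V → ContDiffOn ℝ ∞ Y' V →
    (∀ p ∈ U, fderiv ℝ T p (X p) = X' (T p)) →
    (∀ p ∈ U, fderiv ℝ T p (Y p) = Y' (T p)) →
    ∀ p ∈ U, fderiv ℝ T p (nabla Y p (X p)) = nabla' Y' (T p) (X' (T p))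

theorem intertwines_connection_iff (G H : TypeA) (T : Plane → Plane) (U V : Set Plane) :
    Intertwines G.connection H.connection T U V ↔
      ∀ X Y X' Y' : Plane → Plane,
        ContDiffOn ℝ ∞ X U → ContDiffOn ℝ ∞ Y U → ContDiffOn ℝ ∞ X' V → ContDiffOn ℝ ∞ Y' V →
        (∀ p ∈ U, fderiv ℝ T p (X p) = X' (T p)) →
        (∀ p ∈ U, fderiv ℝ T p (Y p) = Y' (T p)) →
        ∀ p ∈ U, fderiv ℝ T p (G.covDeriv Y p (X p)) = H.covDeriv Y' (T p) (X' (T p)) :=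
  Iff.rfl

/-- Affine equivalence (local affine isomorphism) of two Type A surface geometries: some
diffeomorphism `T` from a non-empty open subset of `ℝ²` onto an open subset of `ℝ²` intertwines
the two connections. All translations preserve both connections, so `T` can then be chosen to be
defined near any given point and to send it to any other given point. -/
def AffineEquivalent (G H : TypeA) : Prop :=
  ∃ T : OpenPartialHomeomorph Plane Plane,
    T.source.Nonempty ∧ ContDiffOn ℝ ∞ T T.source ∧ ContDiffOn ℝ ∞ T.symm T.target ∧
      Intertwines G.connection H.connection T T.source T.target

/-- `Γ₁¹ = Γ(-1, 0, 1, 0, 0, 2)`. -/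
def Gamma1 : TypeA := ⟨-1, 0, 1, 0, 0, 2⟩

/-- `Γ₂¹(c) = Γ(-1, 0, c, 0, 0, 1 + 2c)`, considered for `c ∉ {0, -1}`. -/
noncomputable def Gamma2 (c : ℝ) : TypeA := ⟨-1, 0, c, 0, 0, 1 + 2 * c⟩

/-- `Γ₃¹(c) = Γ(0, 0, c, 0, 0, 1 + 2c)`, considered for `c ∉ {0, -1}`. -/
noncomputable def Gamma3 (c : ℝ) : TypeA := ⟨0, 0, c, 0, 0, 1 + 2 * c⟩

/-- `Γ₄¹(c) = Γ(0, 0, 1, 0, c, 2)`. -/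
def Gamma4 (c : ℝ) : TypeA := ⟨0, 0, 1, 0, c, 2⟩

/-- `Γ₅¹(c) = Γ(1, 0, 0, 0, 1 + c², 2c)`. -/
noncomputable def Gamma5 (c : ℝ) : TypeA := ⟨1, 0, 0, 0, 1 + c ^ 2, 2 * c⟩

/-- The connections `Γ₁¹` and `Γ₄¹(c)`, `c ∈ ℝ`. -/
def family14 : Set TypeA := {G | G = Gamma1 ∨ ∃ c : ℝ, G = Gamma4 c}

/-- The connections `Γ₂¹(c)` and `Γ₃¹(c)`, `c ∈ ℝ \ {0, -1}`. -/
def family23 : Set TypeA := {G | ∃ c : ℝ, c ≠ 0 ∧ c ≠ -1 ∧ (G = Gamma2 c ∨ G = Gamma3 c)}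

/-- The connections `Γ₅¹(c)`, `c ∈ ℝ`. -/
def family5 : Set TypeA := {G | ∃ c : ℝ, G = Gamma5 c}

end AffineSurface

open Filter Topology Set

/-! A local diffeomorphism `T` is affine exactly when D²T(u, v) = DT(Γ(u, v)) - Γ'(DT u, DT v). This
second order system replaces the vector fields throughout.

Non-equivalence: symmetry of the third derivatives of `T` makes DT carry curvature to curvature
(`fderiv_bilinCurvature`). All listed connections have Γ₁₁² = Γ₁₂² = 0, hence ρ = r (dx²)² and ∇ρ =
-2 f r (dx²)³ with r = ae + cf - c². So `T` can only rescale dx² by some t, with r = r't² and f =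
f't (`AffineEquivalent.exists_scaling`), and the sign of r and the ratio f²/r are invariants. The
ratio is 4 for Γ₁, Γ₄; 4 + 1/r with r = c(c + 1) for Γ₂, Γ₃; and 4 - 4/(1 + c²) for Γ₅. These values
give the stated parameters and separate the classes, except that c = -1/2 in Γ₂, Γ₃ and c = 0 in Γ₅
both give 0; there the sign of r decides.

Equivalence: explicit maps (φ, ±x²), with φ = x¹ exp(k x²) + m (x²)² or φ = exp(-x¹ - s x²), send
equivalent connections to a common one (`AffineEquivalentAt.affineEquivalent`). -/

/-! ### Curvature as the integrability condition for affine maps -/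

/-- The curvature `R(w, u) v = B(w, B(u, v)) - B(u, B(w, v))` of the connection on `E` with
constant Christoffel map `B`. -/
noncomputable def bilinCurvature {E : Type*} [NormedAddCommGroup E] [NormedSpace ℝ E] (B : E →L[ℝ] E →L[ℝ] E)
    (w u v : E) : E :=
  B w (B u v) - B u (B w v)

theorem minSmoothness_le_infty : minSmoothness ℝ 2 ≤ (∞ : WithTop ℕ∞) := by
  rw [minSmoothness_of_isRCLikeNormedField]
  exact WithTop.coe_le_coe.2 (le_top : (2 : ℕ∞) ≤ ⊤)

/-- A map which satisfies the second order equation of affine maps intertwines curvatures. -/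
theorem fderiv_bilinCurvature {E F : Type*} [NormedAddCommGroup E] [NormedSpace ℝ E]
    [NormedAddCommGroup F] [NormedSpace ℝ F] {T : E → F} {s : Set E} (hs : IsOpen s)
    (hT : ContDiffOn ℝ ∞ T s) (B : E →L[ℝ] E →L[ℝ] E) (B' : F →L[ℝ] F →L[ℝ] F)
    (h : ∀ p ∈ s, ∀ u v, fderiv ℝ (fderiv ℝ T) p u v =
      fderiv ℝ T p (B u v) - B' (fderiv ℝ T p u) (fderiv ℝ T p v))
    {p : E} (hp : p ∈ s) (w u v : E) :
    fderiv ℝ T p (bilinCurvature B w u v) =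
      bilinCurvature B' (fderiv ℝ T p w) (fderiv ℝ T p u) (fderiv ℝ T p v) := by
  have hD : ContDiffOn ℝ ∞ (fderiv ℝ T) s := hT.fderiv_of_isOpen hs (by simp)
  have hnhds : s ∈ 𝓝 p := hs.mem_nhds hp
  have hDp : HasFDerivAt (fderiv ℝ T) (fderiv ℝ (fderiv ℝ T) p) p :=
    ((hD.contDiffAt hnhds).differentiableAt (by simp)).hasFDerivAt
  have hsymT : IsSymmSndFDerivAt ℝ T p := (hT.contDiffAt hnhds).isSymmSndFDerivAt minSmoothness_le_infty
  have hF : ContDiffAt ℝ ∞ (fun q => fderiv ℝ T q v) p :=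
    (hD.contDiffAt hnhds).clm_apply contDiffAt_const
  have hsymF : IsSymmSndFDerivAt ℝ (fun q => fderiv ℝ T q v) p := hF.isSymmSndFDerivAt minSmoothness_le_infty
  have hFD : ∀ x, HasFDerivAt (fun q => fderiv ℝ T q x)
      ((fderiv ℝ (fderiv ℝ T) p).flip x) p := fun x => by
    simpa using hDp.clm_apply (hasFDerivAt_const x p)
  -- The system differentiated once more in the direction `x`, with `v` frozen.
  have key : ∀ x y, fderiv ℝ (fderiv ℝ (fun q => fderiv ℝ T q v)) p x y =
      fderiv ℝ (fderiv ℝ T) p x (B y v) -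
        (B' (fderiv ℝ T p y) (fderiv ℝ (fderiv ℝ T) p x v) +
          B' (fderiv ℝ (fderiv ℝ T) p x y) (fderiv ℝ T p v)) := fun x y => by
    have h1 : HasFDerivAt (fun q => fderiv ℝ (fun q => fderiv ℝ T q v) q y)
        ((fderiv ℝ (fderiv ℝ (fun q => fderiv ℝ T q v)) p).flip y) p := by
      have : ContDiffAt ℝ ∞ (fderiv ℝ (fun q => fderiv ℝ T q v)) p :=
        hF.fderiv_right (by simp)
      simpa using (this.differentiableAt (by simp)).hasFDerivAt.clm_apply (hasFDerivAt_const y p)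
    have h2 := (hFD (B y v)).sub (B'.hasFDerivAt_of_bilinear (hFD y) (hFD v))
    have h3 : (fun q => fderiv ℝ (fun q => fderiv ℝ T q v) q y) =ᶠ[𝓝 p]
        ((fun q => fderiv ℝ T q (B y v)) -
          fun q => B' (fderiv ℝ T q y) (fderiv ℝ T q v)) := by
      filter_upwards [hnhds] with q hq
      have hq' : DifferentiableAt ℝ (fderiv ℝ T) q :=
        (hD.contDiffAt (hs.mem_nhds hq)).differentiableAt (by simp)
      have := (hq'.hasFDerivAt.clm_apply (hasFDerivAt_const v q)).fderiv
      rw [this]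
      simp [h q hq]
    have h4 := congrArg (fun L => L x) (h1.unique (h2.congr_of_eventuallyEq h3))
    simpa using h4
  -- Swapping `w` and `u` and substituting the system for D²T cancels the mixed terms; what survives
  -- is the curvature identity.
  have h5 := hsymF.eq w u
  rw [key, key, h p hp w (B u v), h p hp u (B w v), h p hp u v, h p hp w v, hsymT.eq w u] at h5
  simp only [bilinCurvature, map_sub] at h5 ⊢
  rw [← sub_eq_zero] at h5 ⊢
  rw [← h5]
  abel

/-! ### Curvature of connections with b = d = 0 -/

namespace AffineSurface

namespace TypeA

theorem bilin_apply_zero (G : TypeA) (v u : Plane) :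
    G.bilin v u 0 = G.a * u 0 * v 0 + G.c * u 0 * v 1 + (G.c * u 1 * v 0 + G.e * u 1 * v 1) := by
  simp [bilin_apply, christoffel]

theorem bilin_apply_one (G : TypeA) (v u : Plane) :
    G.bilin v u 1 = G.b * u 0 * v 0 + G.d * u 0 * v 1 + (G.d * u 1 * v 0 + G.f * u 1 * v 1) := by
  simp [bilin_apply, christoffel]

/-- The Christoffel map of a Type A connection as a continuous bilinear map. -/
noncomputable def bilinMap (G : TypeA) : Plane →L[ℝ] Plane →L[ℝ] Plane :=
  LinearMap.toContinuousLinearMap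
    { toFun := G.bilin
      map_add' := fun v w => by
        ext u k
        fin_cases k
        · simp only [Fin.zero_eta, bilin_apply_zero, add_apply, Pi.add_apply]; ring
        · simp only [Fin.mk_one, bilin_apply_one, add_apply, Pi.add_apply]; ring
      map_smul' := fun r v => by
        ext u k
        fin_cases k
        · simp only [Fin.zero_eta, bilin_apply_zero, smul_apply, Pi.smul_apply, smul_eq_mul,
            RingHom.id_apply]; ring
        · simp only [Fin.mk_one, bilin_apply_one, smul_apply, Pi.smul_apply, smul_eq_mul,
            RingHom.id_apply]; ring }

@[simp]
theorem bilinMap_apply (G : TypeA) (v : Plane) : G.bilinMap v = G.bilin v := rfl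

/-- The coefficient of the Ricci tensor `r (dx²)²` of a Type A connection with `b = d = 0`. -/
def ricci (G : TypeA) : ℝ := G.a * G.e + G.c * G.f - G.c ^ 2

theorem bilinCurvature_apply_zero {G : TypeA} (hb : G.b = 0) (hd : G.d = 0) (w u v : Plane) :
    bilinCurvature G.bilinMap w u v 0 = G.ricci * (w 0 * u 1 - w 1 * u 0) * v 1 := by
  simp only [bilinCurvature, bilinMap_apply, Pi.sub_apply, bilin_apply_zero, bilin_apply_one, hb,
    hd, ricci]
  ring

theorem bilinCurvature_apply_one {G : TypeA} (hb : G.b = 0) (hd : G.d = 0) (w u v : Plane) :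
    bilinCurvature G.bilinMap w u v 1 = 0 := by
  simp only [bilinCurvature, bilinMap_apply, Pi.sub_apply, bilin_apply_one, hb, hd]
  ring

end TypeA

/-! ### The second order system and the invariants r and f -/

section Equation

variable {G H : TypeA} {T : OpenPartialHomeomorph Plane Plane}

theorem differentiableAt_of_contDiffOn {F : Type*} [NormedAddCommGroup F] [NormedSpace ℝ F]
    {Y : Plane → F} {U : Set Plane} (hU : IsOpen U) (hY : ContDiffOn ℝ ∞ Y U) {p : Plane}
    (hp : p ∈ U) : DifferentiableAt ℝ Y p :=
  (hY.contDiffAt (hU.mem_nhds hp)).differentiableAt (by simp)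

theorem contDiffOn_fderiv (hT : ContDiffOn ℝ ∞ T T.source) :
    ContDiffOn ℝ ∞ (fderiv ℝ T) T.source :=
  hT.fderiv_of_isOpen T.open_source (by simp)

theorem fderiv_symm_comp_fderiv (hT : ContDiffOn ℝ ∞ T T.source)
    (hT' : ContDiffOn ℝ ∞ T.symm T.target) {p : Plane} (hp : p ∈ T.source) (u : Plane) :
    fderiv ℝ T.symm (T p) (fderiv ℝ T p u) = u := by
  have h1 := (differentiableAt_of_contDiffOn T.open_source hT hp).hasFDerivAt
  have h2 := (differentiableAt_of_contDiffOn T.open_target hT' (T.map_source hp)).hasFDerivAt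
  have h3 : T.symm ∘ T =ᶠ[𝓝 p] id := by
    filter_upwards [T.open_source.mem_nhds hp] with q hq using T.left_inv hq
  have h4 := ((h2.comp p h1).congr_of_eventuallyEq h3.symm).unique (hasFDerivAt_id p)
  simpa using congrArg (fun L => L u) h4

theorem fderiv_comp_fderiv_symm (hT : ContDiffOn ℝ ∞ T T.source)
    (hT' : ContDiffOn ℝ ∞ T.symm T.target) {p : Plane} (hp : p ∈ T.source) (u : Plane) :
    fderiv ℝ T p (fderiv ℝ T.symm (T p) u) = u := by
  have := fderiv_symm_comp_fderiv (T := T.symm) hT' (by simpa using hT) (T.map_source hp) u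
  simpa [T.left_inv hp] using this

/-- The derivative of the identity `DT(Y) = Y' ∘ T` between related vector fields. -/
theorem fderiv_related (hT : ContDiffOn ℝ ∞ T T.source) {Y Y' : Plane → Plane}
    (hY : ContDiffOn ℝ ∞ Y T.source) (hY' : ContDiffOn ℝ ∞ Y' T.target)
    (h : ∀ p ∈ T.source, fderiv ℝ T p (Y p) = Y' (T p)) {p : Plane} (hp : p ∈ T.source)
    (u : Plane) :
    fderiv ℝ T p (fderiv ℝ Y p u) + fderiv ℝ (fderiv ℝ T) p u (Y p) =
      fderiv ℝ Y' (T p) (fderiv ℝ T p u) := by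
  have h1 := (differentiableAt_of_contDiffOn T.open_source hT hp).hasFDerivAt
  have h2 :=
    (differentiableAt_of_contDiffOn T.open_source (contDiffOn_fderiv hT) hp).hasFDerivAt
  have h3 := (differentiableAt_of_contDiffOn T.open_source hY hp).hasFDerivAt
  have h4 := (differentiableAt_of_contDiffOn T.open_target hY' (T.map_source hp)).hasFDerivAt
  have h5 : (fun q => fderiv ℝ T q (Y q)) =ᶠ[𝓝 p] Y' ∘ T := by
    filter_upwards [T.open_source.mem_nhds hp] with q hq using h q hq
  have h6 := (h2.clm_apply h3).unique ((h4.comp p h1).congr_of_eventuallyEq h5)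
  simpa using congrArg (fun L => L u) h6

/-- Solutions of the second order equation `DT(Γ(u, v)) = D²T(u, v) + Γ'(DT u, DT v)` intertwine
the connections. -/
theorem intertwines_of_equation (hT : ContDiffOn ℝ ∞ T T.source)
    (h : ∀ p ∈ T.source, ∀ u v, fderiv ℝ T p (G.bilin v u) =
      fderiv ℝ (fderiv ℝ T) p u v + H.bilin (fderiv ℝ T p v) (fderiv ℝ T p u)) :
    Intertwines G.connection H.connection T T.source T.target := by
  rw [intertwines_connection_iff]
  intro X Y X' Y' _ hY _ hY' hXX' hYY' p hp
  have := fderiv_related hT hY hY' hYY' hp (X p)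
  rw [TypeA.covDeriv, TypeA.covDeriv, add_apply, add_apply, map_add, h p hp, ← hXX' p hp,
    ← this, hYY' p hp, add_assoc]

/-- The system is pointwise in `u` and `v`, so it suffices to test on constant fields and their
push-forwards DT(T⁻¹ q) w. -/
theorem equation_of_intertwines (hT : ContDiffOn ℝ ∞ T T.source)
    (hT' : ContDiffOn ℝ ∞ T.symm T.target)
    (h : Intertwines G.connection H.connection T T.source T.target) {p : Plane}
    (hp : p ∈ T.source) (u v : Plane) :
    fderiv ℝ T p (G.bilin v u) =
      fderiv ℝ (fderiv ℝ T) p u v + H.bilin (fderiv ℝ T p v) (fderiv ℝ T p u) := by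
  rw [intertwines_connection_iff] at h
  have hpush : ∀ w : Plane, ContDiffOn ℝ ∞ (fun q => fderiv ℝ T (T.symm q) w) T.target :=
    fun w => ((contDiffOn_fderiv hT).comp hT' T.symm.mapsTo).clm_apply contDiffOn_const
  have hrel : ∀ w : Plane, ∀ q ∈ T.source,
      fderiv ℝ T q w = (fun q => fderiv ℝ T (T.symm q) w) (T q) := fun w q hq => by
    simp [T.left_inv hq]
  have h1 := h (fun _ => u) (fun _ => v) _ _ contDiffOn_const contDiffOn_const (hpush u)
    (hpush v) (hrel u) (hrel v) p hp
  have h2 := fderiv_related hT contDiffOn_const (hpush v) (hrel v) hp u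
  simp only [TypeA.covDeriv, add_apply, T.left_inv hp, ← h2] at h1
  simpa using h1

/-- Type A connections with `b = d = 0` and nonzero Ricci tensor which are affine equivalent have
the same tensors `ρ = r (dx²)²` and `∇ρ = -2 f r (dx²)³` up to scaling `dx²`. -/
theorem AffineEquivalent.exists_scaling (hGb : G.b = 0) (hGd : G.d = 0) (hHb : H.b = 0)
    (hHd : H.d = 0) (hH : H.ricci ≠ 0) (h : AffineEquivalent G H) :
    ∃ t : ℝ, G.ricci = H.ricci * t ^ 2 ∧ (t ≠ 0 → G.f = H.f * t) := by
  obtain ⟨T, ⟨p₀, hp₀⟩, hT, hT', hI⟩ := h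
  have heq : ∀ p ∈ T.source, ∀ u v, fderiv ℝ (fderiv ℝ T) p u v =
      fderiv ℝ T p (G.bilinMap u v) - H.bilinMap (fderiv ℝ T p u) (fderiv ℝ T p v) := by
    intro p hp u v
    have := equation_of_intertwines hT hT' hI hp v u
    rw [TypeA.bilinMap_apply, TypeA.bilinMap_apply, this, add_sub_cancel_right]
    exact ((hT.contDiffAt (T.open_source.mem_nhds hp)).isSymmSndFDerivAt minSmoothness_le_infty).eq u v
  have hR := fun p (hp : p ∈ T.source) =>
    fderiv_bilinCurvature T.open_source hT G.bilinMap H.bilinMap heq hp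
  let e₁ : Plane := ![1, 0]
  let e₂ : Plane := ![0, 1]
  -- DT preserves the kernel of the Ricci tensor: R(·, ·)∂₁ = 0 for `G`, while for `H` the product
  -- R(e₁, e₂)(DT e₁) detects the second component of DT e₁.
  have h1 : ∀ p ∈ T.source, fderiv ℝ T p e₁ 1 = 0 := by
    intro p hp
    have := congrFun (hR p hp (fderiv ℝ T.symm (T p) e₁) (fderiv ℝ T.symm (T p) e₂) e₁) 0
    rw [fderiv_comp_fderiv_symm hT hT' hp, fderiv_comp_fderiv_symm hT hT' hp,
      TypeA.bilinCurvature_apply_zero hHb hHd] at this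
    have h0 : bilinCurvature G.bilinMap (fderiv ℝ T.symm (T p) e₁)
        (fderiv ℝ T.symm (T p) e₂) e₁ = 0 := by
      ext k
      fin_cases k
      · simp [TypeA.bilinCurvature_apply_zero hGb hGd, e₁]
      · simp [TypeA.bilinCurvature_apply_one hGb hGd]
    rw [h0] at this
    simpa [e₁, e₂, hH] using this
  -- Both sides of the curvature identity on (e₁, e₂, e₂) are multiples of DT e₁, whose first
  -- component is nonzero by invertibility.
  have h2 : ∀ p ∈ T.source, G.ricci = H.ricci * (fderiv ℝ T p e₂ 1) ^ 2 := by
    intro p hp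
    have := congrFun (hR p hp e₁ e₂ e₂) 0
    have h0 : bilinCurvature G.bilinMap e₁ e₂ e₂ = G.ricci • e₁ := by
      ext k
      fin_cases k
      · simp [TypeA.bilinCurvature_apply_zero hGb hGd, e₁, e₂]
      · simp [TypeA.bilinCurvature_apply_one hGb hGd, e₁]
    rw [TypeA.bilinCurvature_apply_zero hHb hHd, h0, h1 p hp, map_smul, Pi.smul_apply,
      smul_eq_mul] at this
    have hne : fderiv ℝ T p e₁ 0 ≠ 0 := by
      intro h0
      have h3 : fderiv ℝ T p e₁ = 0 := by
        ext k
        fin_cases k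
        · exact h0
        · exact h1 p hp
      have h4 := fderiv_symm_comp_fderiv hT hT' hp e₁
      rw [h3, map_zero] at h4
      simpa [e₁] using congrFun h4 0
    apply mul_right_cancel₀ hne
    rw [this]
    ring
  refine ⟨fderiv ℝ T p₀ e₂ 1, h2 p₀ hp₀, fun ht => ?_⟩
  have h3 : HasFDerivAt (fun q => fderiv ℝ T q e₂ 1)
      ((ContinuousLinearMap.proj (R := ℝ) (φ := fun _ : Fin 2 => ℝ) 1).comp
        ((fderiv ℝ (fderiv ℝ T) p₀).flip e₂)) p₀ := by
    have := (differentiableAt_of_contDiffOn T.open_source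
      (contDiffOn_fderiv hT) hp₀).hasFDerivAt.clm_apply (hasFDerivAt_const e₂ p₀)
    exact ((ContinuousLinearMap.proj (R := ℝ)
      (φ := fun _ : Fin 2 => ℝ) 1).hasFDerivAt.comp p₀ this).congr_fderiv (by ext; simp)
  -- By `h2` the square t² is locally constant, so t ≠ 0 forces the derivative of t to vanish. The
  -- second component of the system at (e₂, e₂) then reads f t = f' t².
  have h4 : HasFDerivAt (fun q => fderiv ℝ T q e₂ 1 ^ 2) (0 : Plane →L[ℝ] ℝ) p₀ := by
    refine (hasFDerivAt_const (G.ricci / H.ricci) p₀).congr_of_eventuallyEq ?_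
    filter_upwards [T.open_source.mem_nhds hp₀] with q hq
    rw [h2 q hq, mul_div_cancel_left₀ _ hH]
  have h5 := congrArg (fun L => L e₂) ((h3.pow 2).unique h4)
  have h6 : fderiv ℝ (fderiv ℝ T) p₀ e₂ e₂ 1 = 0 := by simpa [ht] using h5
  have h7 : G.bilin e₂ e₂ = G.e • e₁ + G.f • e₂ := by
    ext k
    fin_cases k
    · simp [TypeA.bilin_apply_zero, e₁, e₂]
    · simp [TypeA.bilin_apply_one, e₁, e₂]
  have h8 := congrFun (equation_of_intertwines hT hT' hI hp₀ e₂ e₂) 1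
  rw [h7] at h8
  simp only [map_add, map_smul, Pi.add_apply, Pi.smul_apply, smul_eq_mul, h1 p₀ hp₀, h6,
    TypeA.bilin_apply_one, hHb, hHd] at h8
  apply mul_right_cancel₀ ht
  linear_combination h8

end Equation

/-! ### Equivalence through a common third connection -/

section Composition

variable {G H K : TypeA}

/-- Affine equivalence through a map whose image contains the point `q`. -/
def AffineEquivalentAt (G H : TypeA) (q : Plane) : Prop :=
  ∃ T : OpenPartialHomeomorph Plane Plane,
    q ∈ T.target ∧ ContDiffOn ℝ ∞ T T.source ∧ ContDiffOn ℝ ∞ T.symm T.target ∧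
      Intertwines G.connection H.connection T T.source T.target

/-- Two connections which are equivalent to a third one near the same point are equivalent. -/
theorem AffineEquivalentAt.affineEquivalent {q : Plane} (h₁ : AffineEquivalentAt G K q)
    (h₂ : AffineEquivalentAt H K q) : AffineEquivalent G H := by
  obtain ⟨T, hqT, hT, hT', hIT⟩ := h₁
  obtain ⟨S, hqS, hS, hS', hIS⟩ := h₂
  have hsub : (T.trans S.symm).source ⊆ T.source := by
    rw [OpenPartialHomeomorph.trans_source]; exact inter_subset_left
  have hmaps : MapsTo T (T.trans S.symm).source S.target := by
    rw [OpenPartialHomeomorph.trans_source]; exact fun p hp => hp.2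
  have hsub' : (T.trans S.symm).target ⊆ S.source := by
    rw [OpenPartialHomeomorph.trans_target]; exact inter_subset_left
  have hmaps' : MapsTo S (T.trans S.symm).target T.target := by
    rw [OpenPartialHomeomorph.trans_target]; exact fun p hp => hp.2
  have hTS : ContDiffOn ℝ ∞ (T.trans S.symm) (T.trans S.symm).source :=
    hS'.comp (hT.mono hsub) hmaps
  have hTS' : ContDiffOn ℝ ∞ (T.trans S.symm).symm (T.trans S.symm).target :=
    hT'.comp (hS.mono hsub') hmaps'
  refine ⟨T.trans S.symm, ⟨T.symm q, ?_⟩, hTS, hTS', ?_⟩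
  · rw [OpenPartialHomeomorph.trans_source]
    exact ⟨T.map_target hqT, by simpa [T.right_inv hqT] using hqS⟩
  apply intertwines_of_equation hTS
  set R := T.trans S.symm with hR
  have hRS : ∀ p ∈ R.source, R p ∈ S.source := fun p hp => hsub' (R.map_source hp)
  have hSR : ∀ p ∈ R.source, S (R p) = T p := fun p hp => S.right_inv (hmaps hp)
  have hfd : ∀ p ∈ R.source, ∀ u, fderiv ℝ S (R p) (fderiv ℝ R p u) = fderiv ℝ T p u := by
    intro p hp u
    have h1 := (differentiableAt_of_contDiffOn R.open_source hTS hp).hasFDerivAt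
    have h2 := (differentiableAt_of_contDiffOn S.open_source hS (hRS p hp)).hasFDerivAt
    have h3 := (differentiableAt_of_contDiffOn T.open_source hT (hsub hp)).hasFDerivAt
    have h4 : S ∘ R =ᶠ[𝓝 p] T := by
      filter_upwards [R.open_source.mem_nhds hp] with q hq using hSR q hq
    exact congrArg (fun L => L u) ((h2.comp p h1).unique (h3.congr_of_eventuallyEq h4))
  intro p hp u v
  have h1 := (differentiableAt_of_contDiffOn R.open_source hTS hp).hasFDerivAt
  have h2 := (differentiableAt_of_contDiffOn R.open_source (contDiffOn_fderiv hTS)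
    hp).hasFDerivAt
  have h3 := (differentiableAt_of_contDiffOn S.open_source (contDiffOn_fderiv hS)
    (hRS p hp)).hasFDerivAt
  have h4 := (differentiableAt_of_contDiffOn T.open_source (contDiffOn_fderiv hT)
    (hsub hp)).hasFDerivAt
  have h5 : (fun q => fderiv ℝ S (R q) (fderiv ℝ R q v)) =ᶠ[𝓝 p] fun q => fderiv ℝ T q v := by
    filter_upwards [R.open_source.mem_nhds hp] with q hq using hfd q hq v
  have h6 := ((h3.comp p h1).clm_apply (h2.clm_apply (hasFDerivAt_const v p))).unique
    ((h4.clm_apply (hasFDerivAt_const v p)).congr_of_eventuallyEq h5)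
  have h7 : fderiv ℝ S (R p) (fderiv ℝ (fderiv ℝ R) p u v) +
      fderiv ℝ (fderiv ℝ S) (R p) (fderiv ℝ R p u) (fderiv ℝ R p v) =
        fderiv ℝ (fderiv ℝ T) p u v := by
    simpa using congrArg (fun L => L u) h6
  -- `h7` is the second order chain rule for S ∘ R = T. Comparing the systems of `T` and `S` leaves
  -- the system of `R` under the injective map DS.
  have h8 := equation_of_intertwines hT hT' hIT (hsub hp) u v
  have h9 := equation_of_intertwines hS hS' hIS (hRS p hp) (fderiv ℝ R p u) (fderiv ℝ R p v)
  rw [hfd p hp, hfd p hp] at h9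
  rw [← h7, ← hfd p hp] at h8
  rw [← fderiv_symm_comp_fderiv hS hS' (hRS p hp) (fderiv ℝ R p (G.bilin v u)), h8, add_assoc,
    ← h9, ← map_add, fderiv_symm_comp_fderiv hS hS' (hRS p hp)]

theorem AffineEquivalentAt.refl (G : TypeA) (q : Plane) : AffineEquivalentAt G G q := by
  refine ⟨OpenPartialHomeomorph.refl Plane, by simp, by simpa using contDiffOn_id,
    by simpa using contDiffOn_id, intertwines_of_equation (by simpa using contDiffOn_id) ?_⟩
  intro p _ u v
  have : fderiv ℝ (id : Plane → Plane) = fun _ => ContinuousLinearMap.id ℝ Plane :=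
    funext fun _ => fderiv_id
  simp [this]

end Composition

/-! ### Explicit affine maps preserving the fibres x² = const -/

section FiberMaps

/-- The covector `x dx¹ + y dx²`. -/
noncomputable def covector (x y : ℝ) : Plane →L[ℝ] ℝ :=
  x • ContinuousLinearMap.proj 0 + y • ContinuousLinearMap.proj 1

@[simp]
theorem covector_apply (x y : ℝ) (u : Plane) : covector x y u = x * u 0 + y * u 1 := rfl

theorem hasFDerivAt_coord_zero (p : Plane) :
    HasFDerivAt (fun q : Plane => q 0) (covector 1 0) p :=
  (hasFDerivAt_apply (0 : Fin 2) p).congr_fderiv (by ext; simp)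

theorem hasFDerivAt_coord_one (p : Plane) :
    HasFDerivAt (fun q : Plane => q 1) (covector 0 1) p :=
  (hasFDerivAt_apply (1 : Fin 2) p).congr_fderiv (by ext; simp)

/-- Maps of the form `(x¹, x²) ↦ (φ(x¹, x²), ε x²)` between connections with `b = d = 0`. -/
theorem affineEquivalentAt_of_fiberMap {G H : TypeA} (hGb : G.b = 0) (hGd : G.d = 0)
    (hHb : H.b = 0) (hHd : H.d = 0) (T : OpenPartialHomeomorph Plane Plane) {q : Plane}
    (hq : q ∈ T.target) (hT' : ContDiffOn ℝ ∞ T.symm T.target)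
    {φ φ₁ φ₂ φ₁₁ φ₁₂ φ₂₂ : Plane → ℝ} {ε : ℝ} (hTφ : ∀ p, T p = ![φ p, ε * p 1])
    (hφs : ContDiff ℝ ∞ φ)
    (hφ : ∀ p, HasFDerivAt φ (covector (φ₁ p) (φ₂ p)) p)
    (hφ₁ : ∀ p, HasFDerivAt φ₁ (covector (φ₁₁ p) (φ₁₂ p)) p)
    (hφ₂ : ∀ p, HasFDerivAt φ₂ (covector (φ₁₂ p) (φ₂₂ p)) p)
    (hf : G.f * ε = H.f * ε ^ 2)
    (h₁₁ : ∀ p, φ₁₁ p + H.a * φ₁ p ^ 2 = G.a * φ₁ p)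
    (h₁₂ : ∀ p, φ₁₂ p + H.a * φ₁ p * φ₂ p + H.c * ε * φ₁ p = G.c * φ₁ p)
    (h₂₂ : ∀ p, φ₂₂ p + H.a * φ₂ p ^ 2 + 2 * H.c * ε * φ₂ p + H.e * ε ^ 2 =
      G.e * φ₁ p + G.f * φ₂ p) :
    AffineEquivalentAt G H q := by
  have hfun : (T : Plane → Plane) = fun p => ![φ p, ε * p 1] := funext hTφ
  have hT : ContDiff ℝ ∞ T := by
    rw [hfun, contDiff_pi]
    intro k
    fin_cases k
    · exact hφs
    · exact contDiff_const.mul (contDiff_apply ℝ ℝ (1 : Fin 2))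
  have hD : ∀ p u, fderiv ℝ T p u = ![φ₁ p * u 0 + φ₂ p * u 1, ε * u 1] := by
    intro p u
    have h : HasFDerivAt T (ContinuousLinearMap.pi ![covector (φ₁ p) (φ₂ p), covector 0 ε]) p := by
      rw [hfun, hasFDerivAt_pi]
      intro k
      fin_cases k
      · exact hφ p
      · exact ((hasFDerivAt_coord_one p).const_mul ε).congr_fderiv (by ext; simp)
    rw [h.fderiv]
    ext k
    fin_cases k <;> simp
  have hDD : ∀ p u v, fderiv ℝ (fderiv ℝ T) p u v =
      ![(φ₁₁ p * u 0 + φ₁₂ p * u 1) * v 0 + (φ₁₂ p * u 0 + φ₂₂ p * u 1) * v 1, 0] := by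
    intro p u v
    have h1 : HasFDerivAt (fun q => fderiv ℝ T q v) ((fderiv ℝ (fderiv ℝ T) p).flip v) p := by
      have : DifferentiableAt ℝ (fderiv ℝ T) p :=
        ((hT.fderiv_right (m := ∞) (by simp)).differentiable (by simp)) p
      simpa using this.hasFDerivAt.clm_apply (hasFDerivAt_const v p)
    have h2 : HasFDerivAt (fun q => fderiv ℝ T q v)
        (ContinuousLinearMap.pi ![v 0 • covector (φ₁₁ p) (φ₁₂ p) +
          v 1 • covector (φ₁₂ p) (φ₂₂ p), 0]) p := by
      simp only [hD]
      rw [hasFDerivAt_pi]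
      intro k
      fin_cases k
      · exact ((hφ₁ p).mul_const (v 0)).add ((hφ₂ p).mul_const (v 1))
      · exact hasFDerivAt_const (ε * v 1) p
    have h3 := congrArg (fun L => L u) (h1.unique h2)
    rw [ContinuousLinearMap.flip_apply] at h3
    rw [h3]
    ext k
    fin_cases k
    · simp; ring
    · simp
  refine ⟨T, hq, hT.contDiffOn, hT', intertwines_of_equation hT.contDiffOn fun p _ u v => ?_⟩
  rw [hD, hDD]
  ext k
  fin_cases k
  · simp only [Fin.zero_eta, Pi.add_apply, Matrix.cons_val_zero, TypeA.bilin_apply_zero,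
      TypeA.bilin_apply_one, hGb, hGd, hD, Matrix.cons_val_one]
    linear_combination (-(u 0 * v 0)) * h₁₁ p - (u 0 * v 1 + u 1 * v 0) * h₁₂ p -
      u 1 * v 1 * h₂₂ p
  · simp only [Fin.mk_one, Pi.add_apply, Matrix.cons_val_zero,
      TypeA.bilin_apply_one, hGb, hGd, hHb, hHd, hD, Matrix.cons_val_one]
    linear_combination u 1 * v 1 * hf

theorem contDiff_plane {φ ψ : Plane → ℝ} (hφ : ContDiff ℝ ∞ φ) (hψ : ContDiff ℝ ∞ ψ) :
    ContDiff ℝ ∞ (fun p => (![φ p, ψ p] : Plane)) := by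
  rw [contDiff_pi]
  intro k
  fin_cases k
  exacts [hφ, hψ]

theorem contDiffOn_plane {φ ψ : Plane → ℝ} {s : Set Plane} (hφ : ContDiffOn ℝ ∞ φ s)
    (hψ : ContDiffOn ℝ ∞ ψ s) : ContDiffOn ℝ ∞ (fun p => (![φ p, ψ p] : Plane)) s := by
  rw [contDiffOn_pi]
  intro k
  fin_cases k
  exacts [hφ, hψ]

theorem contDiff_coord (k : Fin 2) : ContDiff ℝ ∞ (fun p : Plane => p k) :=
  contDiff_apply ℝ ℝ k

/-- The homeomorphism `(x, y) ↦ (x exp(k y) + m y², ε y)` of the plane, where `ε = ± 1`. -/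
noncomputable def fiberAffine (k m ε : ℝ) (hε : ε * ε = 1) : Plane ≃ₜ Plane where
  toFun p := ![p 0 * Real.exp (k * p 1) + m * p 1 ^ 2, ε * p 1]
  invFun p := ![(p 0 - m * p 1 ^ 2) * Real.exp (-(k * (ε * p 1))), ε * p 1]
  left_inv p := by
    have h : ε * (ε * p 1) = p 1 := by rw [← mul_assoc, hε, one_mul]
    have h' : (ε * p 1) ^ 2 = p 1 ^ 2 := by linear_combination p 1 ^ 2 * hε
    ext j
    fin_cases j
    · simp [h, h', mul_assoc, ← Real.exp_add]
    · simpa using h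
  right_inv p := by
    have h : ε * (ε * p 1) = p 1 := by rw [← mul_assoc, hε, one_mul]
    have h' : (ε * p 1) ^ 2 = p 1 ^ 2 := by linear_combination p 1 ^ 2 * hε
    ext j
    fin_cases j
    · simp [h', mul_assoc, ← Real.exp_add]
    · simpa using h
  continuous_toFun := (contDiff_plane (((contDiff_coord 0).mul
    (contDiff_const.mul (contDiff_coord 1)).exp).add (contDiff_const.mul ((contDiff_coord 1).pow 2)))
      (contDiff_const.mul (contDiff_coord 1))).continuous
  continuous_invFun := (contDiff_plane (((contDiff_coord 0).sub
    (contDiff_const.mul ((contDiff_coord 1).pow 2))).mul (contDiff_const.mul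
      (contDiff_const.mul (contDiff_coord 1))).neg.exp)
      (contDiff_const.mul (contDiff_coord 1))).continuous

/-- The hypotheses come from substituting φ = x exp(k y) + m y² into the system: `hk`, `hm` and `he`
match the coefficients of x exp(k y), of y, and the rest of the 22-equation, while `hak` and `ham`
remove the quadratic terms. -/
theorem affineEquivalentAt_of_fiberAffine {G H : TypeA} (hGb : G.b = 0) (hGd : G.d = 0)
    (hHb : H.b = 0) (hHd : H.d = 0) (q : Plane) (k m ε : ℝ) (hε : ε * ε = 1)
    (hf : G.f * ε = H.f) (ha : G.a = H.a) (hak : H.a * k = 0) (ham : H.a * m = 0)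
    (hc : k + H.c * ε = G.c)
    (hk : k ^ 2 + 2 * H.c * ε * k = G.f * k)
    (hm : 2 * H.c * ε * m = G.f * m)
    (he : ∀ y, 2 * m + H.e = G.e * Real.exp (k * y)) :
    AffineEquivalentAt G H q := by
  have hexp : ∀ p : Plane, HasFDerivAt (fun q : Plane => Real.exp (k * q 1))
      (covector 0 (k * Real.exp (k * p 1))) p := fun p =>
    ((hasFDerivAt_coord_one p).const_mul k).exp.congr_fderiv (by ext; simp; ring)
  refine affineEquivalentAt_of_fiberMap hGb hGd hHb hHd
    (fiberAffine k m ε hε).toOpenPartialHomeomorph (mem_univ q) ?_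
    (φ := fun p => p 0 * Real.exp (k * p 1) + m * p 1 ^ 2)
    (φ₁ := fun p => Real.exp (k * p 1))
    (φ₂ := fun p => k * (p 0 * Real.exp (k * p 1)) + 2 * m * p 1)
    (φ₁₁ := fun _ => 0) (φ₁₂ := fun p => k * Real.exp (k * p 1))
    (φ₂₂ := fun p => k ^ 2 * (p 0 * Real.exp (k * p 1)) + 2 * m) (ε := ε) (fun _ => rfl)
    ?_ ?_ hexp ?_ ?_ ?_ ?_ ?_
  · exact (contDiff_plane (((contDiff_coord 0).sub
      (contDiff_const.mul ((contDiff_coord 1).pow 2))).mul (contDiff_const.mul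
      (contDiff_const.mul (contDiff_coord 1))).neg.exp)
      (contDiff_const.mul (contDiff_coord 1))).contDiffOn
  · exact ((contDiff_coord 0).mul (contDiff_const.mul (contDiff_coord 1)).exp).add
      (contDiff_const.mul ((contDiff_coord 1).pow 2))
  · intro p
    exact (((hasFDerivAt_coord_zero p).mul (hexp p)).add
      (((hasFDerivAt_coord_one p).pow 2).const_mul m)).congr_fderiv (by ext; simp; ring)
  · intro p
    exact ((((hasFDerivAt_coord_zero p).mul (hexp p)).const_mul k).add
      ((hasFDerivAt_coord_one p).const_mul (2 * m))).congr_fderiv (by ext; simp; ring)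
  · rw [hf, pow_two, hε, mul_one]
  · intro p
    rcases mul_eq_zero.1 hak with h | h
    · simp [ha, h]
    · simp [ha, h]
  · intro p
    linear_combination (p 0 * Real.exp (k * p 1) ^ 2) * hak +
      2 * p 1 * Real.exp (k * p 1) * ham + Real.exp (k * p 1) * hc
  · intro p
    linear_combination (k * (p 0 * Real.exp (k * p 1)) ^ 2 +
      2 * (p 0 * Real.exp (k * p 1)) * (2 * m * p 1)) * hak + 4 * m * p 1 ^ 2 * ham +
      p 0 * Real.exp (k * p 1) * hk + 2 * p 1 * hm + he (p 1) + H.e * hε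

/-- The homeomorphism `(x, y) ↦ (exp (-x - s y), ε y)` onto the right half plane, where
`ε = ± 1`. -/
noncomputable def fiberExp (s ε : ℝ) (hε : ε * ε = 1) : OpenPartialHomeomorph Plane Plane where
  toFun p := ![Real.exp (-p 0 - s * p 1), ε * p 1]
  invFun p := ![-Real.log (p 0) - s * (ε * p 1), ε * p 1]
  source := univ
  target := {p | 0 < p 0}
  map_source' p _ := by simpa using Real.exp_pos _
  map_target' _ _ := mem_univ _
  left_inv' p _ := by
    have h : ε * (ε * p 1) = p 1 := by rw [← mul_assoc, hε, one_mul]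
    ext j
    fin_cases j
    · simp [h]
    · simpa using h
  right_inv' p hp := by
    have h : ε * (ε * p 1) = p 1 := by rw [← mul_assoc, hε, one_mul]
    ext j
    fin_cases j
    · simpa using Real.exp_log hp
    · simpa using h
  open_source := isOpen_univ
  open_target := isOpen_lt continuous_const (continuous_apply 0)
  continuousOn_toFun := (contDiff_plane (((contDiff_coord 0).neg.sub
    (contDiff_const.mul (contDiff_coord 1))).exp)
      (contDiff_const.mul (contDiff_coord 1))).continuous.continuousOn
  continuousOn_invFun := (contDiffOn_plane (((contDiff_coord 0).contDiffOn.log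
    fun _ hp => ne_of_gt hp).neg.sub
      (contDiff_const.mul (contDiff_const.mul (contDiff_coord 1))).contDiffOn)
        (contDiff_const.mul (contDiff_coord 1)).contDiffOn).continuousOn

/-- The exponential linearises the first coordinate: φ₁₁ = -φ₁ turns Γ₁₁¹ = -1 into 0. -/
theorem affineEquivalentAt_of_fiberExp {G H : TypeA} (hGb : G.b = 0) (hGd : G.d = 0)
    (hHb : H.b = 0) (hHd : H.d = 0) {q : Plane} (hq : 0 < q 0) (s ε : ℝ) (hε : ε * ε = 1)
    (hf : G.f * ε = H.f) (hGa : G.a = -1) (hGe : G.e = 0) (hHa : H.a = 0) (hHe : H.e = 0)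
    (hc : H.c * ε - s = G.c) (hs : s ^ 2 = s * (2 * H.c * ε - G.f)) :
    AffineEquivalentAt G H q := by
  -- φ and its partial derivatives are multiples of one exponential; the free factor `r` covers them
  -- all, and the unsimplified signs below match it.
  have hφ : ∀ (p : Plane) (r : ℝ), HasFDerivAt (fun q : Plane => r * Real.exp (-q 0 - s * q 1))
      (covector (-r * Real.exp (-p 0 - s * p 1)) (-s * r * Real.exp (-p 0 - s * p 1))) p :=
    fun p r => (((hasFDerivAt_coord_zero p).neg.sub
      ((hasFDerivAt_coord_one p).const_mul s)).exp.const_mul r).congr_fderiv (by ext; simp; ring)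
  refine affineEquivalentAt_of_fiberMap hGb hGd hHb hHd (fiberExp s ε hε) hq ?_
    (φ := fun p => 1 * Real.exp (-p 0 - s * p 1))
    (φ₁ := fun p => -1 * Real.exp (-p 0 - s * p 1))
    (φ₂ := fun p => -s * 1 * Real.exp (-p 0 - s * p 1))
    (φ₁₁ := fun p => - -1 * Real.exp (-p 0 - s * p 1))
    (φ₁₂ := fun p => -s * -1 * Real.exp (-p 0 - s * p 1))
    (φ₂₂ := fun p => -s * (-s * 1) * Real.exp (-p 0 - s * p 1)) (ε := ε)
    (fun p => by rw [one_mul]; rfl)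
    ?_ (fun p => hφ p _) (fun p => hφ p _)
    (fun p => (hφ p _).congr_fderiv (by ext; simp)) ?_ ?_ ?_ ?_
  · exact contDiffOn_plane (((contDiff_coord 0).contDiffOn.log
      fun _ hp => ne_of_gt hp).neg.sub
      (contDiff_const.mul (contDiff_const.mul (contDiff_coord 1))).contDiffOn)
        (contDiff_const.mul (contDiff_coord 1)).contDiffOn
  · exact contDiff_const.mul ((contDiff_coord 0).neg.sub
      (contDiff_const.mul (contDiff_coord 1))).exp
  · rw [hf, pow_two, hε, mul_one]
  · intro p
    rw [hHa, hGa]; ring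
  · intro p
    rw [hHa]
    linear_combination (-Real.exp (-p 0 - s * p 1)) * hc
  · intro p
    rw [hHa, hHe, hGe]
    linear_combination Real.exp (-p 0 - s * p 1) * hs

end FiberMaps

/-! ### Equivalences and invariants of the listed families -/

section Families

/-- The base point (1, 0) lies in the right half plane, the image of the exponential maps. -/
theorem family14_equivalentAt {G : TypeA} (hG : G ∈ family14) :
    AffineEquivalentAt G (Gamma4 0) ![1, 0] := by
  rcases hG with rfl | ⟨c, rfl⟩
  · apply affineEquivalentAt_of_fiberExp (s := 0) (ε := 1) <;> simp [Gamma1, Gamma4]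
  · apply affineEquivalentAt_of_fiberAffine (k := 0) (m := c / 2) (ε := 1) <;>
      simp [Gamma4]
    ring

theorem gamma23_equivalentAt (c c' : ℝ) (h : c' = c ∨ c' = -1 - c) {H : TypeA}
    (hH : H = Gamma2 c' ∨ H = Gamma3 c') : AffineEquivalentAt H (Gamma3 c) ![1, 0] := by
  rcases h with rfl | rfl <;> rcases hH with rfl | rfl
  · apply affineEquivalentAt_of_fiberExp (s := 0) (ε := 1) <;> simp [Gamma2, Gamma3]
  · exact AffineEquivalentAt.refl _ _
  -- This map is (exp(-x), y) followed by (x exp(-y), -y), the map of the next case.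
  · apply affineEquivalentAt_of_fiberExp (s := 1) (ε := -1) <;> simp [Gamma2, Gamma3] <;> ring
  · apply affineEquivalentAt_of_fiberAffine (k := -1) (m := 0) (ε := -1) <;>
      simp [Gamma3] <;> ring

theorem gamma5_equivalentAt (c : ℝ) : AffineEquivalentAt (Gamma5 (-c)) (Gamma5 c) ![1, 0] := by
  apply affineEquivalentAt_of_fiberAffine (k := 0) (m := 0) (ε := -1) <;> simp [Gamma5]

/-- For connections with `b = d = 0` and Ricci coefficient `r ≠ 0`, the sign of `r` and the ratio
`f ^ 2 / r` are invariants of affine equivalence. -/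
theorem AffineEquivalent.f_sq_mul_ricci {G H : TypeA} (hGb : G.b = 0) (hGd : G.d = 0)
    (hHb : H.b = 0) (hHd : H.d = 0) (hG : G.ricci ≠ 0) (hH : H.ricci ≠ 0)
    (h : AffineEquivalent G H) :
    0 < G.ricci * H.ricci ∧ G.f ^ 2 * H.ricci = H.f ^ 2 * G.ricci := by
  obtain ⟨t, h1, h2⟩ := h.exists_scaling hGb hGd hHb hHd hH
  have ht : t ≠ 0 := by
    rintro rfl
    exact hG (by rw [h1]; ring)
  rw [h2 ht, h1]
  constructor
  · have := mul_pos (pow_pos (abs_pos.2 hH) 2) (pow_pos (abs_pos.2 ht) 2)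
    rw [sq_abs, sq_abs] at this
    linarith
  · ring

/-- The class of connections with `b = d = 0`, the given Ricci coefficient `r` and given `f`. -/
def HasInvariants (G : TypeA) (r f : ℝ) : Prop :=
  G.b = 0 ∧ G.d = 0 ∧ G.ricci = r ∧ G.f = f

/-- The conclusion is symmetric, so one comparison excludes equivalence in both directions. -/
theorem HasInvariants.compare {G H : TypeA} {r f r' f' : ℝ} (hG : HasInvariants G r f)
    (hH : HasInvariants H r' f') (hr : r ≠ 0) (hr' : r' ≠ 0)
    (h : AffineEquivalent G H ∨ AffineEquivalent H G) :
    0 < r * r' ∧ f ^ 2 * r' = f' ^ 2 * r := by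
  obtain ⟨hGb, hGd, rfl, rfl⟩ := hG
  obtain ⟨hHb, hHd, rfl, rfl⟩ := hH
  rcases h with h | h
  · exact h.f_sq_mul_ricci hGb hGd hHb hHd hr hr'
  · obtain ⟨h1, h2⟩ := h.f_sq_mul_ricci hHb hHd hGb hGd hr' hr
    exact ⟨by rwa [mul_comm], h2.symm⟩

theorem hasInvariants_family14 {G : TypeA} (hG : G ∈ family14) : HasInvariants G 1 2 := by
  rcases hG with rfl | ⟨c, rfl⟩ <;> refine ⟨rfl, rfl, ?_, rfl⟩ <;>
    norm_num [TypeA.ricci, Gamma1, Gamma4]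

theorem hasInvariants_gamma23 {c : ℝ} {G : TypeA} (hG : G = Gamma2 c ∨ G = Gamma3 c) :
    HasInvariants G (c * (c + 1)) (1 + 2 * c) := by
  rcases hG with rfl | rfl <;> refine ⟨rfl, rfl, ?_, rfl⟩ <;>
    simp only [TypeA.ricci, Gamma2, Gamma3] <;> ring

theorem hasInvariants_gamma5 (c : ℝ) : HasInvariants (Gamma5 c) (1 + c ^ 2) (2 * c) := by
  refine ⟨rfl, rfl, ?_, rfl⟩
  simp only [TypeA.ricci, Gamma5]
  ring

theorem mul_add_one_ne_zero {c : ℝ} (h : c ≠ 0) (h' : c ≠ -1) : c * (c + 1) ≠ 0 :=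
  mul_ne_zero h fun h0 => h' (eq_neg_of_add_eq_zero_left h0)

end Families
end AffineSurface

open AffineSurface

theorem theorem3p7 :
    -- `Γ₁¹` and all the `Γ₄¹(c)` are mutually affine equivalent
    (∀ G ∈ AffineSurface.family14, ∀ H ∈ AffineSurface.family14,
      AffineSurface.AffineEquivalent G H) ∧
    -- `Γᵢ¹(c)` and `Γⱼ¹(c')` for `i, j ∈ {2, 3}`
    (∀ c c' : ℝ, c ≠ 0 → c ≠ -1 → c' ≠ 0 → c' ≠ -1 →
      ∀ G : AffineSurface.TypeA, G = AffineSurface.Gamma2 c ∨ G = AffineSurface.Gamma3 c →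
      ∀ H : AffineSurface.TypeA, H = AffineSurface.Gamma2 c' ∨ H = AffineSurface.Gamma3 c' →
        (AffineSurface.AffineEquivalent G H ↔ c' = c ∨ c' = -1 - c)) ∧
    -- `Γ₅¹(c)` and `Γ₅¹(c')`
    (∀ c c' : ℝ, AffineSurface.AffineEquivalent (AffineSurface.Gamma5 c) (AffineSurface.Gamma5 c') ↔
      c = c' ∨ c = -c') ∧
    -- there are no other affine equivalences
    (∀ G ∈ AffineSurface.family14, ∀ H ∈ AffineSurface.family23,
      ¬ AffineSurface.AffineEquivalent G H ∧ ¬ AffineSurface.AffineEquivalent H G) ∧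
    (∀ G ∈ AffineSurface.family14, ∀ H ∈ AffineSurface.family5,
      ¬ AffineSurface.AffineEquivalent G H ∧ ¬ AffineSurface.AffineEquivalent H G) ∧
    (∀ G ∈ AffineSurface.family23, ∀ H ∈ AffineSurface.family5,
      ¬ AffineSurface.AffineEquivalent G H ∧ ¬ AffineSurface.AffineEquivalent H G) := by
  have sep : ∀ {G H : TypeA}, ¬ (AffineEquivalent G H ∨ AffineEquivalent H G) →
      ¬ AffineEquivalent G H ∧ ¬ AffineEquivalent H G := fun h => not_or.1 h
  refine ⟨?_, ?_, ?_, ?_, ?_, ?_⟩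
  · intro G hG H hH
    exact (family14_equivalentAt hG).affineEquivalent (family14_equivalentAt hH)
  · intro c c' hc hc1 hc' hc1' G hG H hH
    refine ⟨fun h => ?_, fun h => ?_⟩
    · have h1 := ((hasInvariants_gamma23 hG).compare (hasInvariants_gamma23 hH)
        (mul_add_one_ne_zero hc hc1) (mul_add_one_ne_zero hc' hc1') (Or.inl h)).2
      -- Since f² = 1 + 4r, equality of f²/r gives r = r', which factors this way.
      have h2 : (c' - c) * (c' - (-1 - c)) = 0 := by linear_combination h1
      rcases mul_eq_zero.1 h2 with h3 | h3
      · exact Or.inl (sub_eq_zero.1 h3)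
      · exact Or.inr (sub_eq_zero.1 h3)
    · exact (gamma23_equivalentAt c c (Or.inl rfl) hG).affineEquivalent
        (gamma23_equivalentAt c c' h hH)
  · intro c c'
    refine ⟨fun h => ?_, ?_⟩
    · have h1 := ((hasInvariants_gamma5 c).compare (hasInvariants_gamma5 c')
        (by positivity) (by positivity) (Or.inl h)).2
      exact sq_eq_sq_iff_eq_or_eq_neg.1 (by linear_combination h1 / 4)
    · rintro (rfl | rfl)
      · exact (AffineEquivalentAt.refl _ ![1, 0]).affineEquivalent (AffineEquivalentAt.refl _ _)
      · exact (gamma5_equivalentAt c').affineEquivalent (AffineEquivalentAt.refl _ _)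
  · rintro G hG H ⟨c, hc, hc1, hH⟩
    refine sep fun h => ?_
    have h1 := ((hasInvariants_family14 hG).compare (hasInvariants_gamma23 hH) one_ne_zero
      (mul_add_one_ne_zero hc hc1) h).2
    linarith
  · rintro G hG H ⟨c, rfl⟩
    refine sep fun h => ?_
    have h1 := ((hasInvariants_family14 hG).compare (hasInvariants_gamma5 c) one_ne_zero
      (by positivity) h).2
    linarith
  · rintro G ⟨c, hc, hc1, hG⟩ H ⟨c', rfl⟩
    refine sep fun h => ?_
    obtain ⟨h1, h2⟩ := (hasInvariants_gamma23 hG).compare (hasInvariants_gamma5 c')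
      (mul_add_one_ne_zero hc hc1) (by positivity) h
    -- The sign is needed: with r = c(c + 1), `h2` reduces to 1 + 4r + c'² = 0, which is solvable at
    -- c = -1/2, c' = 0 but not for r > 0.
    have h3 : 0 < c * (c + 1) := pos_of_mul_pos_left h1 (by positivity)
    nlinarith [sq_nonneg c']
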